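/- **Setting.** Let $\Omega\subset\mathbb R^n$ be a bounded Lipschitz domain (open, connected) with outer unit normal $\nu$, let $\Gamma_D\neq\emptyset$ be a relatively open part of $\partial\Omega$, and $\Gamma_N=\partial\Omega\setminus\overline{\Gamma_D}$. Write $A:B=\operatorname{tr}(AB)$, $|A|=\sqrt{A:A}$ and $A_D=A-\frac{\operatorname{tr}A}{n}I$ for symmetric matrices, $a\odot b=\frac12(a\otimes b+b\otimes a)$, and let $\mathbb M_D^{n\times n}$ be the space of symmetric trace-free matrices. Functions in $BD(\Omega)$ and $H^1(\Omega;\mathbb R^n)$ and their traces on $\partial\Omega$ are denoted by the same letter, and $E$ is the symmetrized gradient. For $\hat w\in H^1(\Omega;\mathbb R^n)$ let $\mathcal A(\hat w)$ be the set of all $(u,e,p)\in BD(\Omega)\times L^2(\Omega;\mathbb M^{n\times n}_{sym})\times\mathcal M(\Omega\cup\Gamma_D;\mathbb M_D^{n\times n})$ (bounded measures) with $Eu=e+p$ in $\Omega$ and $p=(\hat w-u)\odot\nu\,\mathcal H^{n-1}$ on $\Gamma_D$. Let $\Sigma$ be the set of all $\sigma\in L^2(\Omega;\mathbb M^{n\times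 n}_{sym})$ with $\operatorname{div}\sigma\in L^n(\Omega;\mathbb R^n)$, $\sigma\nu\in L^\infty(\Gamma_N;\mathbb R^n)$ and $\sigma_D\in L^\infty(\Omega;\mathbb M_D^{n\times n})$. For $\sigma\in\Sigma$ and $(u,e,p)\in\mathcal A(\hat w)$ define, for $\varphi\in C_c^\infty(\mathbb R^n)$, $$\langle[\sigma_D:p],\varphi\rangle=\int_\Omega\varphi\,\sigma:(E\hat w-e)\,dx-\int_\Omega\varphi\,\operatorname{div}\sigma\cdot(u-\hat w)\,dx-\int_\Omega\sigma:[(u-\hat w)\odot\nabla\varphi]\,dx+\int_{\Gamma_N}\varphi\,\sigma\nu\cdot(u-\hat w)\,d\mathcal H^{n-1}.$$ Assume that $\Omega$ is admissible: for all such $\sigma$ and $(u,e,p)$ (and all $\hat w$) this distribution extends to a bounded Radon measure on $\mathbb R^n$ with $|[\sigma_D:p]|\le\|\sigma_D\|_\infty|p|$. Let $K=\{\tau\in\mathbb M_D^{n\times n}:|\tau|\le1\}$ (von Mises) with support function $H(A)=\sup_{\tau\in K}\tau:A$, and put $H(p)=H\big(\tfrac{dp}{d|p|}\big)|p|$ for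 a measure $p$. Let $f\in L^n(\Omega;\mathbb R^n)$, $g\in L^\infty(\Gamma_N;\mathbb R^n)$ and $\dot w\in H^1(\Omega;\mathbb R^n)$ be the body force, the surface force and the boundary velocity at a fixed time. A pair $(\sigma,v)\in L^2(\Omega;\mathbb M^{n\times n}_{sym})\times BD(\Omega)$ is a solution of the rigid-plastic system at that time if $$\begin{cases}-\operatorname{div}\sigma=f&\text{in }\Omega,\\ \sigma\nu=g&\text{on }\Gamma_N,\\ \sigma_D(x)\in K&\text{for a.e. }x\in\Omega,\end{cases}\qquad\begin{cases}\operatorname{div}v=0&\text{in }\Omega,\\(\dot w-v)\cdot\nu=0&\text{on }\Gamma_D,\\ H(Ev)=[\sigma_D:Ev]&\text{in }\Omega\cup\Gamma_D,\end{cases}$$ where $Ev$ is extended to $\Gamma_D$ by $(\dot w-v)\odot\nu\,\mathcal H^{n-1}$, so that $(v,0,Ev)\in\mathcal A(\dot w)$. **Proposition.** Let $(\sigma^1,v^1)$ and $(\sigma^2,v^2)$ be two solutions of this system for the same data $f,g,\dot w$. Then: * there exist two $|Ev^1|$-measurable functions $\hat\sigma_D^1,\hat\sigma_D^2\in L^\infty_{|Ev^1|}(\Omega\cup\Gamma_D;\mathbb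 M_D^{n\times n})$ such that $\hat\sigma_D^1=\sigma_D^1$ and $\hat\sigma_D^2=\sigma_D^2$ $\mathcal L^n$-a.e. in $\Omega\cup\Gamma_D$, and $\hat\sigma_D^1=\hat\sigma_D^2$ $|Ev^1|$-a.e. in $\Omega\cup\Gamma_D$; * there exist two $|Ev^2|$-measurable functions $\tilde\sigma_D^1,\tilde\sigma_D^2\in L^\infty_{|Ev^2|}(\Omega\cup\Gamma_D;\mathbb M_D^{n\times n})$ such that $\tilde\sigma_D^1=\sigma_D^1$ and $\tilde\sigma_D^2=\sigma_D^2$ $\mathcal L^n$-a.e. in $\Omega\cup\Gamma_D$, and $\tilde\sigma_D^1=\tilde\sigma_D^2$ $|Ev^2|$-a.e. in $\Omega\cup\Gamma_D$. -/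

import Mathlib

open MeasureTheory Set Filter Topology
open scoped ContDiff ENNReal

noncomputable section

namespace RigidPlastic

/-! ### Vectors and matrices -/

/-- Points and vectors of `ℝⁿ`, with the Euclidean norm. -/
abbrev Vec (n : ℕ) := EuclideanSpace ℝ (Fin n)

/-- Real `n × n` matrices `A`, with entries `A (i, j)`, as a Euclidean space: the scalar product
`inner ℝ A B = ∑ i j, A i j * B i j` is `A : B`, and the norm is `|A| = √(A : A)`. -/
abbrev Mat (n : ℕ) := EuclideanSpace ℝ (Fin n × Fin n)

variable {n : ℕ}

/-- The trace of a matrix. -/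
def tr (A : Mat n) : ℝ := ∑ i, A (i, i)

/-- The matrix is symmetric. -/
def IsSym (A : Mat n) : Prop := ∀ i j, A (i, j) = A (j, i)

/-- The identity matrix. -/
def idMat (n : ℕ) : Mat n := WithLp.toLp 2 fun q => if q.1 = q.2 then 1 else 0

/-- The symmetrized tensor product `a ⊙ b`. -/
def symOuter (a b : Vec n) : Mat n :=
  WithLp.toLp 2 fun q => (a q.1 * b q.2 + a q.2 * b q.1) / 2

/-- The symmetric part of a matrix. -/
def symPart (A : Mat n) : Mat n := WithLp.toLp 2 fun q => (A (q.1, q.2) + A (q.2, q.1)) / 2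

/-- The deviatoric part `A_D = A - (tr A / n) I`. -/
def dev (A : Mat n) : Mat n := A - (tr A / n) • idMat n

/-- The set `M_D` of symmetric trace free matrices. -/
def devMat (n : ℕ) : Set (Mat n) := {A | IsSym A ∧ tr A = 0}

/-- The product of a matrix and a vector. -/
def mulV (A : Mat n) (a : Vec n) : Vec n := WithLp.toLp 2 fun i => ∑ j, A (i, j) * a j

/-- The support function `H(A) = sup {τ : A | τ ∈ K}` of `K`. -/
def supportFn (K : Set (Mat n)) (A : Mat n) : ℝ := sSup ((fun τ => inner ℝ τ A) '' K)

/-- The von Mises set, i.e. the closed unit ball of the deviatoric matrices. -/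
def vonMises (n : ℕ) : Set (Mat n) := {τ | τ ∈ devMat n ∧ ‖τ‖ ≤ 1}

/-! ### Domains -/

/-- Near each of its boundary points, `Ω` is the strict subgraph, in some direction `a`, of a
Lipschitz function of the component orthogonal to `a`. -/
def HasLipschitzBoundary (Ω : Set (Vec n)) : Prop :=
  ∀ x ∈ frontier Ω, ∃ a : Vec n, ‖a‖ = 1 ∧ ∃ r : ℝ, 0 < r ∧
    ∃ (L : NNReal) (h : Vec n → ℝ), LipschitzWith L h ∧
      ∀ y ∈ Metric.ball x r, (y ∈ Ω ↔ inner ℝ a y < h (y - inner ℝ a y • a))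

/-- `ν` is the outer unit normal to `Ω` at `x`: near `x`, the set `Ω` contains each open cone
about `-ν`, and is disjoint from each open cone about `ν`, of opening less than a half-space. -/
def IsOuterNormal (Ω : Set (Vec n)) (x ν : Vec n) : Prop :=
  ‖ν‖ = 1 ∧ ∀ ε : ℝ, 0 < ε → ∀ᶠ y in 𝓝 x,
    (inner ℝ (y - x) ν < -ε * ‖y - x‖ → y ∈ Ω) ∧ (ε * ‖y - x‖ < inner ℝ (y - x) ν → y ∉ Ω)

open scoped Classical in
/-- The outer unit normal, which is unique where it exists (almost everywhere on a Lipschitz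
boundary, by Rademacher's theorem); the value is `0` elsewhere. -/
def outerNormal (Ω : Set (Vec n)) (x : Vec n) : Vec n :=
  if h : ∃ ν, IsOuterNormal Ω x ν then h.choose else 0

/-- The surface measure: the `(n-1)`-dimensional Hausdorff measure, normalized so that it is
the Lebesgue measure on hyperplanes, restricted to `∂Ω`. -/
def surf (Ω : Set (Vec n)) : Measure (Vec n) :=
  (Measure.euclideanHausdorffMeasure (n - 1)).restrict (frontier Ω)

/-- The Neumann part `Γ_N = ∂Ω \ closure Γ_D` of the boundary. -/
def neumann (Ω ΓD : Set (Vec n)) : Set (Vec n) := frontier Ω \ closure ΓD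

/-- The geometric assumptions: `Ω` is a bounded Lipschitz domain and `Γ_D` is a nonempty,
relatively open part of its boundary. -/
structure IsReferenceDomain (Ω ΓD : Set (Vec n)) : Prop where
  isOpen : IsOpen Ω
  isConnected : IsConnected Ω
  isBounded : Bornology.IsBounded Ω
  lipschitz : HasLipschitzBoundary Ω
  dirichlet_nonempty : ΓD.Nonempty
  dirichlet_open : ∃ U : Set (Vec n), IsOpen U ∧ ΓD = U ∩ frontier Ω

/-! ### Weak derivatives, functions of bounded deformation, traces -/

/-- `φ ∈ C_c^∞(U)`. -/
structure IsTest (U : Set (Vec n)) (φ : Vec n → ℝ) : Prop where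
  smooth : ContDiff ℝ ∞ φ
  compact : HasCompactSupport φ
  supp : tsupport φ ⊆ U

/-- `u ∈ BD(Ω)` and the bounded measure `μ` (extended by zero outside `Ω`) is the distributional
symmetrized gradient `Eu`. -/
structure HasStrain (Ω : Set (Vec n)) (u : Vec n → Vec n)
    (μ : VectorMeasure (Vec n) (Mat n)) : Prop where
  integrable : IntegrableOn u Ω
  bounded : IsFiniteMeasure μ.variation
  concentrated : ∀ B, MeasurableSet B → μ B = μ (B ∩ Ω)
  weak : ∀ φ, IsTest Ω φ →
    ∫ x in Ω, symOuter (u x) (gradient φ x) = -VectorMeasure.integral μ φ (.lsmul ℝ ℝ)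

/-- `u ∈ BD(Ω)` and `γ ∈ L¹(∂Ω)` is its trace, characterized by Green's formula
`∫_∂Ω φ γ ⊙ ν = ∫_Ω u ⊙ ∇φ + ∫_Ω φ dEu` for all `φ ∈ C_c^∞(ℝⁿ)`. -/
def HasTrace (Ω : Set (Vec n)) (u γ : Vec n → Vec n) : Prop :=
  ∃ μ : VectorMeasure (Vec n) (Mat n), HasStrain Ω u μ ∧ Integrable γ (surf Ω) ∧
    ∀ φ, IsTest univ φ →
      ∫ x, φ x • symOuter (γ x) (outerNormal Ω x) ∂(surf Ω) =
        (∫ x in Ω, symOuter (u x) (gradient φ x)) + VectorMeasure.integral μ φ (.lsmul ℝ ℝ)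

/-- `w ∈ H¹(Ω; ℝⁿ)` and `G` is its weak gradient, `G (i, j) = ∂_j w_i`. -/
structure HasH1Gradient (Ω : Set (Vec n)) (w : Vec n → Vec n) (G : Vec n → Mat n) : Prop where
  memLp : MemLp w 2 (volume.restrict Ω)
  memLp_grad : MemLp G 2 (volume.restrict Ω)
  weak : ∀ φ, IsTest Ω φ → ∀ i j,
    ∫ x in Ω, w x i * gradient φ x j = -∫ x in Ω, φ x * G x (i, j)

/-- `div σ = d` in `Ω`, in the sense of distributions. -/
def HasDiv (Ω : Set (Vec n)) (σ : Vec n → Mat n) (d : Vec n → Vec n) : Prop :=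
  ∀ φ, IsTest Ω φ → ∫ x in Ω, mulV (σ x) (gradient φ x) = -∫ x in Ω, φ x • d x

/-- `σν = g` on `Γ_N`, where `div σ = d`: the normal trace of `σ` is the functional
`ψ ↦ ∫_Ω σ : ∇ψ + ∫_Ω div σ · ψ` on the `H¹` functions whose trace vanishes outside `Γ_N`. -/
def HasNormalTrace (Ω ΓD : Set (Vec n)) (σ : Vec n → Mat n) (d g : Vec n → Vec n) : Prop :=
  ∀ (ψ : Vec n → Vec n) (G : Vec n → Mat n) (γ : Vec n → Vec n),
    HasH1Gradient Ω ψ G → HasTrace Ω ψ γ →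
    (∀ᵐ x ∂(surf Ω), x ∉ neumann Ω ΓD → γ x = 0) →
      (∫ x in Ω, inner ℝ (σ x) (G x)) + (∫ x in Ω, inner ℝ (d x) (ψ x)) =
        ∫ x in neumann Ω ΓD, inner ℝ (g x) (γ x) ∂(surf Ω)

/-! ### Admissible stresses and strains, duality pairing -/

/-- `σ ∈ Σ`, with `div σ = d ∈ Lⁿ(Ω; ℝⁿ)` and `σν = g ∈ L^∞(Γ_N; ℝⁿ)`. -/
structure IsStress (Ω ΓD : Set (Vec n)) (σ : Vec n → Mat n) (d g : Vec n → Vec n) : Prop where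
  symm : ∀ᵐ x ∂(volume.restrict Ω), IsSym (σ x)
  memLp : MemLp σ 2 (volume.restrict Ω)
  memLp_div : MemLp d n (volume.restrict Ω)
  div : HasDiv Ω σ d
  memLp_normal : MemLp g ∞ ((surf Ω).restrict (neumann Ω ΓD))
  normal : HasNormalTrace Ω ΓD σ d g
  memLp_dev : MemLp (fun x => dev (σ x)) ∞ (volume.restrict Ω)

/-- `(u, e, p) ∈ A(w)`, where `γw` and `γu` are the traces of `w` and `u`; the measure `p` on
`Ω ∪ Γ_D` is extended by zero to `ℝⁿ`. -/
structure IsKinAdmissible (Ω ΓD : Set (Vec n)) (γw : Vec n → Vec n)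
    (u γu : Vec n → Vec n) (e : Vec n → Mat n)
    (p : VectorMeasure (Vec n) (Mat n)) : Prop where
  trace : HasTrace Ω u γu
  memLp_elastic : MemLp e 2 (volume.restrict Ω)
  symm_elastic : ∀ᵐ x ∂(volume.restrict Ω), IsSym (e x)
  bounded : IsFiniteMeasure p.variation
  concentrated : ∀ B, MeasurableSet B → p B = p (B ∩ (Ω ∪ ΓD))
  deviatoric : ∀ B, MeasurableSet B → p B ∈ devMat n
  /-- `Eu = e + p` in `Ω`. -/
  strain : ∀ φ, IsTest Ω φ →
    ∫ x in Ω, symOuter (u x) (gradient φ x) =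
      -((∫ x in Ω, φ x • e x) + VectorMeasure.integral p φ (.lsmul ℝ ℝ))
  /-- `p = (w - u) ⊙ ν` on `Γ_D`. -/
  boundary : ∀ B, MeasurableSet B → B ⊆ ΓD →
    p B = ∫ x in B, symOuter (γw x - γu x) (outerNormal Ω x) ∂(surf Ω)

/-- The distribution `⟨[σ_D : p], φ⟩`; here `div σ = d` in `Ω`, `σν = g` on `Γ_N`, `G = ∇w`, and
`γw`, `γu` are the traces of `w`, `u`. -/
def pairing (Ω ΓD : Set (Vec n)) (σ : Vec n → Mat n) (d g : Vec n → Vec n)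
    (w : Vec n → Vec n) (G : Vec n → Mat n) (γw : Vec n → Vec n)
    (u γu : Vec n → Vec n) (e : Vec n → Mat n) (φ : Vec n → ℝ) : ℝ :=
  (∫ x in Ω, φ x * inner ℝ (σ x) (symPart (G x) - e x))
    - (∫ x in Ω, φ x * inner ℝ (d x) (u x - w x))
    - (∫ x in Ω, inner ℝ (σ x) (symOuter (u x - w x) (gradient φ x)))
    + ∫ x in neumann Ω ΓD, φ x * inner ℝ (g x) (γu x - γw x) ∂(surf Ω)

/-- The bounded real measure `m` on `ℝⁿ` extends the distribution `T` on `C_c^∞(ℝⁿ)`. -/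
def Represents (m : SignedMeasure (Vec n)) (T : (Vec n → ℝ) → ℝ) : Prop :=
  ∀ φ, IsTest univ φ → VectorMeasure.integral m φ (.lsmul ℝ ℝ) = T φ

/-- The domain `Ω` (with the Dirichlet part `Γ_D`) is admissible: each `[σ_D : p]` extends to a
bounded measure on `ℝⁿ` with `|[σ_D : p]| ≤ ‖σ_D‖_∞ |p|`. -/
def IsAdmissible (Ω ΓD : Set (Vec n)) : Prop :=
  ∀ (σ : Vec n → Mat n) (d g : Vec n → Vec n), IsStress Ω ΓD σ d g →
  ∀ (w : Vec n → Vec n) (G : Vec n → Mat n) (γw : Vec n → Vec n),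
    HasH1Gradient Ω w G → HasTrace Ω w γw →
  ∀ (u γu : Vec n → Vec n) (e : Vec n → Mat n) (p : VectorMeasure (Vec n) (Mat n)),
    IsKinAdmissible Ω ΓD γw u γu e p →
  ∃ m : SignedMeasure (Vec n), Represents m (pairing Ω ΓD σ d g w G γw u γu e) ∧
    m.variation ≤ eLpNorm (fun x => dev (σ x)) ∞ (volume.restrict Ω) • p.variation

/-! ### The rigid-plastic model at a fixed time -/

/-- `ξ` is the Radon-Nikodym derivative `dp / d|p|`. -/
structure IsPolarDensity (p : VectorMeasure (Vec n) (Mat n)) (ξ : Vec n → Mat n) : Prop where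
  integrable : Integrable ξ p.variation
  eq_integral : ∀ B, MeasurableSet B → p B = ∫ x in B, ξ x ∂p.variation

/-- `m = H(p)` on `S`, where `H` is the support function of `K` and
`H(p) = H(dp / d|p|) |p|`. -/
def EqDissipation (S : Set (Vec n)) (K : Set (Mat n)) (p : VectorMeasure (Vec n) (Mat n))
    (m : SignedMeasure (Vec n)) : Prop :=
  ∃ ξ, IsPolarDensity p ξ ∧
    ∀ B, MeasurableSet B → B ⊆ S → m B = ∫ x in B, supportFn K (ξ x) ∂p.variation

/-- `(σ, v)` solves the rigid-plastic model at a given time, with body force `f`, surface force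
`g`, and boundary velocity `w` (with gradient `G` and trace `γw`).  Here `γv` is the trace of
`v`, and `Ev` is the strain rate measure on `Ω ∪ Γ_D`: it is the symmetrized gradient of `v` in
`Ω`, and `(w - v) ⊙ ν` on `Γ_D`, that is, `(v, 0, Ev) ∈ A(w)`. -/
structure IsSolution (Ω ΓD : Set (Vec n)) (K : Set (Mat n)) (f g : Vec n → Vec n)
    (w : Vec n → Vec n) (G : Vec n → Mat n) (γw : Vec n → Vec n)
    (σ : Vec n → Mat n) (v γv : Vec n → Vec n) (Ev : VectorMeasure (Vec n) (Mat n)) : Prop where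
  symm : ∀ᵐ x ∂(volume.restrict Ω), IsSym (σ x)
  memLp : MemLp σ 2 (volume.restrict Ω)
  /-- `-div σ = f` in `Ω`. -/
  equilibrium : HasDiv Ω σ (fun x => -f x)
  /-- `σν = g` on `Γ_N`. -/
  traction : HasNormalTrace Ω ΓD σ (fun x => -f x) g
  /-- `σ_D ∈ K` almost everywhere. -/
  yield : ∀ᵐ x ∂(volume.restrict Ω), dev (σ x) ∈ K
  strainRate : IsKinAdmissible Ω ΓD γw v γv (fun _ => 0) Ev
  /-- `div v = 0` in `Ω`. -/
  incompressible : ∀ φ, IsTest Ω φ → ∫ x in Ω, inner ℝ (v x) (gradient φ x) = 0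
  /-- `(w - v) · ν = 0` on `Γ_D`. -/
  tangential : ∀ᵐ x ∂((surf Ω).restrict ΓD), inner ℝ (γw x - γv x) (outerNormal Ω x) = 0
  /-- `H(Ev) = [σ_D : Ev]` in `Ω ∪ Γ_D`. -/
  flowRule : ∃ m : SignedMeasure (Vec n),
    Represents m (pairing Ω ΓD σ (fun x => -f x) g w G γw v γv (fun _ => 0)) ∧
    EqDissipation (Ω ∪ ΓD) K Ev m

/-- For the measure `μ` on `Ω ∪ Γ_D`, the deviatoric parts of `σ₁` and `σ₂` have representatives
in `L^∞_|μ|(Ω ∪ Γ_D; M_D)` that coincide `|μ|`-almost everywhere. -/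
def DevAgree (Ω ΓD : Set (Vec n)) (μ : VectorMeasure (Vec n) (Mat n))
    (σ₁ σ₂ : Vec n → Mat n) : Prop :=
  ∃ s₁ s₂ : Vec n → Mat n,
    (∀ x, s₁ x ∈ devMat n) ∧ (∀ x, s₂ x ∈ devMat n) ∧
    MemLp s₁ ∞ (μ.variation.restrict (Ω ∪ ΓD)) ∧ MemLp s₂ ∞ (μ.variation.restrict (Ω ∪ ΓD)) ∧
    (∀ᵐ x ∂(volume.restrict (Ω ∪ ΓD)), s₁ x = dev (σ₁ x)) ∧
    (∀ᵐ x ∂(volume.restrict (Ω ∪ ΓD)), s₂ x = dev (σ₂ x)) ∧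
    ∀ᵐ x ∂(μ.variation.restrict (Ω ∪ ΓD)), s₁ x = s₂ x

end RigidPlastic

end

noncomputable section

namespace RigidPlastic

/-! ### Vector measures with density, and test functions -/

section

variable {n : ℕ}

/-! For the von Mises set, `H` is the norm on deviatoric matrices, so the flow rule says `[σⁱ_D :
Evⁱ] = |Evⁱ|`, while the yield condition and admissibility give `[σʲ_D : Evⁱ] ≤ |Evⁱ|` for the other
stress. Both stresses have the same divergence and traction. Hence, tested with a function equal to
1 near the closure of `Ω`, the difference of the two pairings with one velocity does not depend on
that velocity (`pairing_sub_pairing`). With `v¹` it is nonnegative and with `v²` nonpositive, so it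
is zero. The mixed pairings therefore have maximal mass, which forces `[σʲ_D : Evⁱ] = |Evⁱ|` as
measures (`eq_variation_of_univ`).

It remains to localize. If `|p|` has a bounded density on a set `S ⊆ Ω`, the corresponding part of
`p` can be counted as elastic strain `e`. This changes the pairing by exactly `σ : e dx`, and the
bound for the new pairing shows that it does not charge `S` (`pairing_apply_eq_setIntegral`). So on
the absolutely continuous part of `|p|` one gets `σ_D : ξ = 1` with `ξ = dp/d|p|`, and equality in
Cauchy–Schwarz gives `σ_D = ξ` (`ae_dev_eq_polar`). The rest of `|p|` lives on a Lebesgue null set,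
where both representatives may be set equal to `ξ`. -/

instance isFiniteMeasure_variation_signedMeasure {X : Type*} [MeasurableSpace X]
    (m : SignedMeasure X) : IsFiniteMeasure m.variation := by
  rw [← SignedMeasure.totalVariation_eq_variation]
  unfold SignedMeasure.totalVariation
  infer_instance

/-- Integration against the vector measure with density `f`. -/
theorem integral_withDensityᵥ {X E : Type*} [MeasurableSpace X] [NormedAddCommGroup E]
    [NormedSpace ℝ E] [CompleteSpace E] {ν : Measure X} {f : X → E} (hf : Integrable f ν)
    {φ : X → ℝ} (hφ : (ν.withDensityᵥ f).Integrable φ) :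
    VectorMeasure.integral (ν.withDensityᵥ f) φ (.lsmul ℝ ℝ) = ∫ x, φ x • f x ∂ν := by
  have hvar : (ν.withDensityᵥ f).variation = ν.withDensity (fun x ↦ ‖f x‖ₑ) :=
    Measure.variation_withDensityᵥ hf
  have hlt : ∀ᵐ x ∂ν, ‖f x‖ₑ < ⊤ := Eventually.of_forall fun x => enorm_lt_top
  have hint : ∀ g : X → ℝ, (ν.withDensityᵥ f).Integrable g → Integrable (fun x => g x • f x) ν := by
    intro g hg
    rw [VectorMeasure.Integrable, hvar] at hg
    have h2 := (integrable_withDensity_iff_integrable_smul₀' hf.aestronglyMeasurable.enorm hlt).1 hg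
    refine h2.mono ?_ (Eventually.of_forall fun x => ?_)
    -- Measurability is only known for `‖f‖ • g`; multiplying by `‖f‖⁻¹ • f` recovers `g • f`, both
    -- sides being zero where `f = 0`.
    · refine (h2.aestronglyMeasurable.smul
        (hf.aestronglyMeasurable.norm.inv₀.smul hf.aestronglyMeasurable)).congr
        (Eventually.of_forall fun x => ?_)
      by_cases h0 : f x = 0
      · simp [h0]
      · have : ‖f x‖ ≠ 0 := by simpa using h0
        simp only [toReal_enorm, smul_eq_mul, Pi.smul_apply', smul_smul, Pi.inv_apply]
        congr 1
        field_simp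
    · simp [norm_smul, mul_comm]
  refine MeasureTheory.Integrable.induction (μ := (ν.withDensityᵥ f).variation)
    (P := fun φ => VectorMeasure.integral (ν.withDensityᵥ f) φ (.lsmul ℝ ℝ) =
      ∫ x, φ x • f x ∂ν) ?_ ?_ ?_ ?_ hφ
  · intro c s hs hc
    have : IsFiniteMeasure ((ν.withDensityᵥ f).variation.restrict s) := ⟨by simpa using hc⟩
    rw [VectorMeasure.integral_indicator_const c hs, withDensityᵥ_apply hf hs]
    have : (fun x => s.indicator (fun _ => c) x • f x) = s.indicator (fun x => c • f x) := by
      ext x; by_cases hx : x ∈ s <;> simp [hx]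
    rw [this, integral_indicator hs, integral_smul]
    rfl
  · intro g h _ hg hh eg eh
    rw [VectorMeasure.integral_add hg hh, eg, eh, ← integral_add (hint _ hg) (hint _ hh)]
    simp [add_smul]
  · refine isClosed_eq VectorMeasure.continuous_integral ?_
    -- Since the variation has density `‖f‖` with respect to `ν`, the map `g ↦ ∫ g • f ∂ν` is
    -- 1-Lipschitz on `L¹` of the variation.
    refine LipschitzWith.continuous (K := 1) (LipschitzWith.of_dist_le_mul fun g g' => ?_)
    have hg := hint _ (L1.integrable_coeFn g)
    have hg' := hint _ (L1.integrable_coeFn g')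
    rw [dist_eq_norm, ← integral_sub hg hg', NNReal.coe_one, one_mul, dist_eq_norm,
      L1.norm_eq_integral_norm]
    have e1 : ∫ x, ‖(g - g' : X →₁[(ν.withDensityᵥ f).variation] ℝ) x‖ ∂(ν.withDensityᵥ f).variation
        = ∫ x, ‖g x - g' x‖ ∂(ν.withDensityᵥ f).variation := by
      apply integral_congr_ae
      filter_upwards [Lp.coeFn_sub g g'] with x hx
      exact congrArg norm hx
    have e2 : ∫ x, ‖g x - g' x‖ ∂(ν.withDensityᵥ f).variation
        = ∫ x, ‖g x • f x - g' x • f x‖ ∂ν := by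
      refine (congrArg (fun μ => ∫ x, ‖g x - g' x‖ ∂μ) hvar).trans ?_
      rw [integral_withDensity_eq_integral_toReal_smul₀ hf.aestronglyMeasurable.enorm hlt]
      apply integral_congr_ae
      filter_upwards with x
      rw [← sub_smul, norm_smul, toReal_enorm, smul_eq_mul, mul_comm]
    rw [e1, e2]
    exact norm_integral_le_integral_norm _
  · intro g h hgh _ eg
    rw [← VectorMeasure.integral_congr_ae hgh, eg]
    apply integral_congr_ae
    rw [hvar] at hgh
    have := (ae_withDensity_iff' hf.aestronglyMeasurable.enorm).1 hgh
    filter_upwards [this] with x hx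
    by_cases h0 : f x = 0
    · simp [h0]
    · rw [hx (by simpa using h0)]

theorem IsTest.exists_bound {U : Set (Vec n)} {φ : Vec n → ℝ} (h : IsTest U φ) :
    ∃ C, ∀ x, ‖φ x‖ ≤ C := h.compact.exists_bound_of_continuous h.smooth.continuous

theorem IsTest.integrable {U : Set (Vec n)} {φ : Vec n → ℝ} (h : IsTest U φ)
    (μ : Measure (Vec n)) [IsFiniteMeasure μ] : Integrable φ μ := by
  obtain ⟨C, hC⟩ := h.exists_bound
  exact Integrable.of_bound h.smooth.continuous.aestronglyMeasurable C (Eventually.of_forall hC)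

theorem eq_withDensityᵥ_variation (m : SignedMeasure (Vec n)) :
    ∃ h, Integrable h m.variation ∧ m.variation.withDensityᵥ h = m := by
  refine ⟨m.rnDeriv m.variation, m.integrable_rnDeriv _, m.withDensityᵥ_rnDeriv_eq _ ?_⟩
  refine VectorMeasure.AbsolutelyContinuous.mk fun s hs h0 => ?_
  rw [Measure.toENNRealVectorMeasure_apply_measurable hs] at h0
  have := m.enorm_measure_le_variation s
  rw [h0] at this
  simpa using this

/-- A signed measure is determined by its integrals of test functions. -/
theorem signedMeasure_ext_of_test {m₁ m₂ : SignedMeasure (Vec n)}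
    (h : ∀ φ, IsTest univ φ → VectorMeasure.integral m₁ φ (.lsmul ℝ ℝ) =
      VectorMeasure.integral m₂ φ (.lsmul ℝ ℝ)) : m₁ = m₂ := by
  rw [← sub_eq_zero]
  obtain ⟨f, hf, hm⟩ := eq_withDensityᵥ_variation (m₁ - m₂)
  have h0 : ∀ᵐ x ∂(m₁ - m₂).variation, f x = 0 := by
    -- The difference is written as a density against its own variation, so the fundamental lemma of
    -- the calculus of variations applies to that density.
    refine ae_eq_zero_of_integral_contDiff_smul_eq_zero hf.locallyIntegrable fun φ h1 h2 => ?_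
    have hφ : IsTest univ φ := ⟨h1, h2, subset_univ _⟩
    rw [← integral_withDensityᵥ hf (by rw [hm]; exact hφ.integrable _), hm,
      VectorMeasure.integral_sub_vectorMeasure (hφ.integrable _) (hφ.integrable _), h φ hφ,
      sub_self]
  rw [← hm]
  ext s hs
  rw [withDensityᵥ_apply hf hs, integral_congr_ae (ae_restrict_of_ae h0)]
  simp

end

/-! ### Deviatoric matrices, and the boundary as a Lebesgue null set -/

section

variable {n : ℕ}

theorem continuous_tr : Continuous (tr : Mat n → ℝ) := by
  unfold tr; fun_prop

theorem continuous_dev : Continuous (dev : Mat n → Mat n) := by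
  have := continuous_tr (n := n)
  unfold dev; fun_prop

theorem isClosed_devMat : IsClosed (devMat n) := by
  have h : devMat n = (⋂ i, ⋂ j, {A : Mat n | A (i, j) = A (j, i)}) ∩ {A | tr A = 0} := by
    ext A; simp [devMat, IsSym]
  rw [h]
  exact (isClosed_iInter fun i => isClosed_iInter fun j =>
    isClosed_eq (by fun_prop) (by fun_prop)).inter (isClosed_eq continuous_tr continuous_const)

theorem zero_mem_devMat : (0 : Mat n) ∈ devMat n := by simp [devMat, IsSym, tr]

theorem smul_mem_devMat (c : ℝ) {A : Mat n} (h : A ∈ devMat n) : c • A ∈ devMat n := by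
  refine ⟨fun i j => by simp [h.1 i j], ?_⟩
  have := h.2
  simp only [tr, PiLp.smul_apply, smul_eq_mul, ← Finset.mul_sum] at this ⊢
  rw [this, mul_zero]

theorem dev_mem_devMat (hn : n ≠ 0) {A : Mat n} (h : IsSym A) : dev A ∈ devMat n := by
  refine ⟨fun i j => by simp [dev, idMat, h i j, eq_comm], ?_⟩
  have hn' : (n : ℝ) ≠ 0 := by exact_mod_cast hn
  simp only [tr, dev, idMat, PiLp.sub_apply, PiLp.smul_apply, smul_eq_mul, if_true, mul_one,
    Finset.sum_sub_distrib, Finset.sum_const, Finset.card_univ, Fintype.card_fin, nsmul_eq_mul]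
  field_simp
  simp

theorem inner_idMat (B : Mat n) : inner ℝ (idMat n) B = tr B := by
  simp [idMat, PiLp.inner_apply, tr, Fintype.sum_prod_type]

/-- The spherical part of a stress does no work on a trace-free strain, so `σ` and `σ_D` are
interchangeable in the pairing density. -/
theorem inner_dev (A : Mat n) {B : Mat n} (hB : B ∈ devMat n) :
    inner ℝ (dev A) B = inner ℝ A B := by
  rw [dev, inner_sub_left, inner_smul_left, inner_idMat, hB.2]; simp

theorem supportFn_vonMises {A : Mat n} (hA : A ∈ devMat n) :
    supportFn (vonMises n) A = ‖A‖ := by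
  -- The maximizer is the direction of `A`; for `A = 0` the convention `0⁻¹ = 0` makes it the zero
  -- matrix, which still lies in the von Mises set.
  refine IsGreatest.csSup_eq ⟨⟨‖A‖⁻¹ • A, ⟨smul_mem_devMat _ hA, ?_⟩, ?_⟩, ?_⟩
  · rw [norm_smul, norm_inv, norm_norm]; exact inv_mul_le_one
  · simp only [inner_smul_left, real_inner_self_eq_norm_sq]
    by_cases h : ‖A‖ = 0
    · simp [h]
    · simp; field_simp
  · rintro _ ⟨τ, hτ, rfl⟩
    calc inner ℝ τ A ≤ ‖τ‖ * ‖A‖ := real_inner_le_norm _ _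
      _ ≤ 1 * ‖A‖ := by gcongr; exact hτ.2
      _ = ‖A‖ := one_mul _

/-- Equality in Cauchy–Schwarz: `‖a - b‖² = ‖a‖² - 2 + ‖b‖² ≤ 0`. This is where the strict convexity
of the von Mises set enters. -/
theorem eq_of_inner_eq_one {E : Type*} [NormedAddCommGroup E] [InnerProductSpace ℝ E] {a b : E}
    (ha : ‖a‖ ≤ 1) (hb : ‖b‖ ≤ 1) (h : inner ℝ a b = 1) : a = b := by
  have := norm_sub_sq_real a b
  rw [h] at this
  have h3 : ‖a - b‖ ^ 2 ≤ 0 := by nlinarith [norm_nonneg a, norm_nonneg b]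
  rw [← sub_eq_zero, ← norm_eq_zero]
  exact pow_eq_zero_iff (two_ne_zero) |>.1 (le_antisymm h3 (sq_nonneg _))

/-- The density of a measure with values in `devMat` takes values in `devMat`. -/
theorem ae_mem_devMat {μ : Measure (Vec n)} {ξ : Vec n → Mat n} (hξ : Integrable ξ μ)
    (h : ∀ B, MeasurableSet B → ∫ x in B, ξ x ∂μ ∈ devMat n) : ∀ᵐ x ∂μ, ξ x ∈ devMat n := by
  -- The deviatoric matrices are the common kernel of finitely many linear functionals, each of
  -- which commutes with the integral.
  have key : ∀ ℓ : Mat n →L[ℝ] ℝ, (∀ A ∈ devMat n, ℓ A = 0) → ∀ᵐ x ∂μ, ℓ (ξ x) = 0 := by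
    intro ℓ hℓ
    refine Integrable.ae_eq_zero_of_forall_setIntegral_eq_zero (ℓ.integrable_comp hξ)
      fun s hs _ => ?_
    rw [ℓ.integral_comp_comm hξ.integrableOn]
    exact hℓ _ (h s hs)
  have h1 : ∀ i j, ∀ᵐ x ∂μ, ξ x (i, j) = ξ x (j, i) := by
    intro i j
    have := key (EuclideanSpace.proj (i, j) - EuclideanSpace.proj (j, i))
      (fun A hA => by simp [hA.1 i j])
    filter_upwards [this] with x hx
    simpa [sub_eq_zero] using hx
  have h2 := key (∑ i, EuclideanSpace.proj (i, i)) (fun A hA => by simpa [tr] using hA.2)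
  simp only [← ae_all_iff] at h1
  filter_upwards [h1, h2] with x hx hx2
  exact ⟨hx, by simpa [tr] using hx2⟩

/-- Near each of its points the boundary lies in a Lipschitz graph in direction `a`: points strictly
above the graph are exterior, points strictly below lie in the open set `Ω`. Distinct translates of
a graph along `a` are disjoint, and infinitely many such translates by bounded vectors force measure
zero. -/
theorem volume_frontier_eq_zero {Ω : Set (Vec n)} (ho : IsOpen Ω) (hl : HasLipschitzBoundary Ω) :
    volume (frontier Ω) = 0 := by
  refine measure_null_of_locally_null _ fun x hx => ?_
  obtain ⟨a, ha, r, hr, L, h, hL, hy⟩ := hl x hx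
  have hc : Continuous fun y : Vec n => h (y - inner ℝ a y • a) :=
    hL.continuous.comp (by fun_prop)
  have hi : Continuous fun y : Vec n => (inner ℝ a y : ℝ) := by fun_prop
  refine ⟨frontier Ω ∩ Metric.ball x r,
    inter_mem_nhdsWithin _ (Metric.ball_mem_nhds x hr), ?_⟩
  have hsub : frontier Ω ∩ Metric.ball x r ⊆ {y | inner ℝ a y = h (y - inner ℝ a y • a)} := by
    rintro y ⟨hyf, hyb⟩
    rw [mem_ofPred_eq]
    rw [ho.frontier_eq] at hyf
    refine le_antisymm (le_of_not_gt fun hlt => ?_) (le_of_not_gt fun hlt => ?_)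
    · have hN := (isOpen_lt hc hi).inter Metric.isOpen_ball |>.mem_nhds ⟨hlt, hyb⟩
      obtain ⟨z, hz, hzΩ⟩ := mem_closure_iff_nhds.1 hyf.1 _ hN
      exact absurd ((hy z hz.2).1 hzΩ) (not_lt.2 hz.1.le)
    · exact hyf.2 ((hy y hyb).2 hlt)
  refine measure_mono_null hsub ?_
  have hinj : ∀ (y : Vec n) (t : ℝ), inner ℝ a y = h (y - inner ℝ a y • a) →
      inner ℝ a (t • a + y) = h (t • a + y - inner ℝ a (t • a + y) • a) → t = 0 := by
    intro y t h1 h2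
    have e : inner ℝ a (t • a + y) = t + inner ℝ a y := by
      rw [inner_add_right, inner_smul_right, real_inner_self_eq_norm_sq, ha]; ring
    have e2 : t • a + y - (t + inner ℝ a y) • a = y - inner ℝ a y • a := by
      rw [add_smul]; abel
    rw [e, e2, ← h1] at h2
    linarith
  refine Measure.addHaar_eq_zero_of_disjoint_translates volume
    (fun k : ℕ => ((k : ℝ) + 1)⁻¹ • a) ?_ ?_ (isClosed_eq hi hc).measurableSet
  · refine (Metric.isBounded_closedBall (x := (0 : Vec n)) (r := 1)).subset ?_
    rintro _ ⟨k, rfl⟩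
    rw [mem_closedBall_zero_iff, norm_smul, ha, mul_one, Real.norm_of_nonneg (by positivity)]
    exact inv_le_one_of_one_le₀ (by simp)
  · intro i j hij
    rw [Function.onFun, Set.disjoint_left]
    rintro z hz1 hz2
    rw [singleton_add, mem_image] at hz1 hz2
    obtain ⟨y, h1, rfl⟩ := hz1
    obtain ⟨y', h2, h3⟩ := hz2
    apply hij
    have h4 : y' = (((i : ℝ) + 1)⁻¹ - ((j : ℝ) + 1)⁻¹) • a + y := by
      rw [sub_smul, sub_add_eq_add_sub, ← h3, add_sub_cancel_left]
    rw [h4] at h2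
    have := hinj y _ h1 h2
    rw [sub_eq_zero, inv_inj, add_left_inj] at this
    exact_mod_cast this

end

/-! ### Localizing the duality pairing on the absolutely continuous part -/

section

variable {n : ℕ}

theorem _root_.MeasureTheory.MemLp.integrable_inner_two {X E : Type*} [MeasurableSpace X]
    [NormedAddCommGroup E] [InnerProductSpace ℝ E] {μ : Measure X} {f g : X → E}
    (hf : MemLp f 2 μ) (hg : MemLp g 2 μ) : Integrable (fun x => (inner ℝ (f x) (g x) : ℝ)) μ :=
  (hf.norm.integrable_mul hg.norm).mono (hf.1.inner hg.1)
    (Eventually.of_forall fun x => by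
      simpa using abs_real_inner_le_norm (f x) (g x))

theorem memLp_symPart {μ : Measure (Vec n)} {G : Vec n → Mat n} (h : MemLp G 2 μ) :
    MemLp (fun x => symPart (G x)) 2 μ := by
  have hc : Continuous (symPart : Mat n → Mat n) := by unfold symPart; fun_prop
  refine MemLp.of_eval_piLp fun q => ?_
  have h1 : MemLp (fun x => G x (q.1, q.2)) 2 μ := h.eval_piLp _
  have h2 : MemLp (fun x => G x (q.2, q.1)) 2 μ := h.eval_piLp _
  simpa [symPart, div_eq_inv_mul] using (h1.add h2).const_mul (2⁻¹ : ℝ)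

variable {Ω ΓD : Set (Vec n)} {σ : Vec n → Mat n} {d g w : Vec n → Vec n} {G : Vec n → Mat n}
  {γw u γu : Vec n → Vec n} {p : VectorMeasure (Vec n) (Mat n)}

/-- A bounded absolutely continuous part of the plastic strain on `S ⊆ Ω` can be moved to the
elastic strain. -/
theorem IsKinAdmissible.transfer (hmeas : MeasurableSet (Ω ∪ ΓD)) (hdisj : Disjoint Ω ΓD) (hk : IsKinAdmissible Ω ΓD γw u γu (fun _ => 0) p)
    {S : Set (Vec n)} (hS : MeasurableSet S) (hSΩ : S ⊆ Ω) {e : Vec n → Mat n}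
    (he : MemLp e 2 (volume.restrict Ω)) (hei : Integrable e) (hdev : ∀ x, e x ∈ devMat n)
    (hsupp : ∀ x ∉ S, e x = 0)
    (hpS : p.restrict S = volume.withDensityᵥ e) :
    IsKinAdmissible Ω ΓD γw u γu e (p.restrict Sᶜ) := by
  have := hk.bounded
  refine ⟨hk.trace, he, Eventually.of_forall fun x => (hdev x).1, inferInstance, ?_, ?_, ?_, ?_⟩
  · intro B hB
    rw [VectorMeasure.restrict_apply _ hS.compl hB,
      VectorMeasure.restrict_apply _ hS.compl (hB.inter hmeas), hk.concentrated _ (hB.inter hS.compl),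
      inter_right_comm]
  · intro B hB
    rw [VectorMeasure.restrict_apply _ hS.compl hB]
    exact hk.deviatoric _ (hB.inter hS.compl)
  · intro φ hφ
    have h1 : (volume.withDensityᵥ e).Integrable φ := by
      rw [← hpS]; exact hφ.integrable _
    have h2 : VectorMeasure.integral p φ (.lsmul ℝ ℝ) = (∫ x, φ x • e x) +
        VectorMeasure.integral (p.restrict Sᶜ) φ (.lsmul ℝ ℝ) := by
      rw [← integral_withDensityᵥ hei h1, ← hpS, ← VectorMeasure.integral_add_vectorMeasure
        (hφ.integrable _) (hφ.integrable _), VectorMeasure.restrict_add_restrict_compl hS]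
    rw [hk.strain φ hφ, h2]
    simp only [smul_zero, integral_zero, zero_add]
    rw [setIntegral_eq_integral_of_forall_compl_eq_zero
      fun x hx => by rw [hsupp x fun h => hx (hSΩ h), smul_zero]]
  · intro B hB hBD
    rw [VectorMeasure.restrict_apply _ hS.compl hB, ← hk.boundary B hB hBD,
      inter_eq_left.2 (show B ⊆ Sᶜ from fun x hx hxS => hdisj.le_bot ⟨hSΩ hxS, hBD hx⟩)]

/-- The density of the duality pairing with respect to a bounded absolutely continuous part of the
plastic strain. -/
theorem pairing_apply_eq_setIntegral (hmeas : MeasurableSet (Ω ∪ ΓD)) (hb : Bornology.IsBounded Ω)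
    (hdisj : Disjoint Ω ΓD) (hadm : IsAdmissible Ω ΓD) (hσ : IsStress Ω ΓD σ d g)
    (hw : HasH1Gradient Ω w G) (hγw : HasTrace Ω w γw)
    (hk : IsKinAdmissible Ω ΓD γw u γu (fun _ => 0) p)
    {m : SignedMeasure (Vec n)}
    (hm : Represents m (pairing Ω ΓD σ d g w G γw u γu (fun _ => 0)))
    {S : Set (Vec n)} (hS : MeasurableSet S) (hSΩ : S ⊆ Ω) {e : Vec n → Mat n}
    (hem : StronglyMeasurable e) {C : ℝ} (hC : ∀ x, ‖e x‖ ≤ C) (hdev : ∀ x, e x ∈ devMat n)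
    (hsupp : ∀ x ∉ S, e x = 0) (hpS : p.restrict S = volume.withDensityᵥ e)
    {B : Set (Vec n)} (hB : MeasurableSet B) (hBS : B ⊆ S) :
    m B = ∫ x in B, inner ℝ (σ x) (e x) := by
  have hfin : IsFiniteMeasure (volume.restrict Ω) := ⟨by simpa using hb.measure_lt_top⟩
  have he2 : MemLp e 2 (volume.restrict Ω) :=
    MemLp.of_bound hem.aestronglyMeasurable C (Eventually.of_forall hC)
  have hei : Integrable e := by
    rw [← integrableOn_iff_integrable_of_support_subset (s := Ω)]
    · exact he2.integrable (by norm_num)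
    · intro x hx
      by_contra h
      exact hx (hsupp x fun h' => h (hSΩ h'))
  have hk' := hk.transfer hmeas hdisj hS hSΩ he2 hei hdev hsupp hpS
  obtain ⟨m', hm', hbound⟩ := hadm σ d g hσ w G γw hw hγw u γu e _ hk'
  have hσe : Integrable (fun x => (inner ℝ (σ x) (e x) : ℝ)) := by
    rw [← integrableOn_iff_integrable_of_support_subset (s := Ω)]
    · exact hσ.memLp.integrable_inner_two he2
    · intro x hx
      by_contra h
      exact hx (by simp only [hsupp x fun h' => h (hSΩ h'), inner_zero_right])
  -- In the definition of the pairing only the first integral involves the elastic strain, so the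
  -- two distributions differ by `φ ↦ ∫ φ σ : e`.
  have hmm : m = m' + volume.withDensityᵥ (fun x => (inner ℝ (σ x) (e x) : ℝ)) := by
    refine signedMeasure_ext_of_test fun φ hφ => ?_
    rw [VectorMeasure.integral_add_vectorMeasure (hφ.integrable _) (hφ.integrable _), hm φ hφ,
      hm' φ hφ, integral_withDensityᵥ hσe (hφ.integrable _)]
    obtain ⟨Cφ, hCφ⟩ := hφ.exists_bound
    have i1 : Integrable (fun x => φ x * inner ℝ (σ x) (symPart (G x))) (volume.restrict Ω) :=
      (hσ.memLp.integrable_inner_two (memLp_symPart hw.memLp_grad)).bdd_mul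
        hφ.smooth.continuous.aestronglyMeasurable (Eventually.of_forall hCφ)
    have i2 : Integrable (fun x => φ x * inner ℝ (σ x) (e x)) (volume.restrict Ω) :=
      (hσ.memLp.integrable_inner_two he2).bdd_mul
        hφ.smooth.continuous.aestronglyMeasurable (Eventually.of_forall hCφ)
    have e1 : ∫ x, φ x • (inner ℝ (σ x) (e x) : ℝ) = ∫ x in Ω, φ x * inner ℝ (σ x) (e x) := by
      rw [setIntegral_eq_integral_of_forall_compl_eq_zero
        fun x hx => by rw [hsupp x fun h => hx (hSΩ h), inner_zero_right, mul_zero]]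
      rfl
    simp only [pairing, sub_zero, e1, inner_sub_right, mul_sub]
    rw [integral_sub i1 i2]
    ring
  -- The remaining plastic strain lives on `Sᶜ`, and its variation dominates that of `m'` up to a
  -- constant.
  have h0 : m' B = 0 := by
    have h1 := (m'.enorm_measure_le_variation B).trans (hbound B)
    rw [Measure.smul_apply, VectorMeasure.variation_restrict hS.compl,
      Measure.restrict_apply hB, show B ∩ Sᶜ = ∅ from sdiff_eq_empty.2 hBS, measure_empty, smul_zero] at h1
    simpa using h1
  rw [hmm, add_apply, h0, zero_add, withDensityᵥ_apply hσe hB]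

/-- If the duality pairing attains the dissipation, then the deviatoric stress is the polar density
of the plastic strain almost everywhere on its absolutely continuous part. -/
theorem ae_dev_eq_polar (hmeas : MeasurableSet (Ω ∪ ΓD)) (ho : IsOpen Ω)
    (hb : Bornology.IsBounded Ω)
    (hdisj : Disjoint Ω ΓD) (hadm : IsAdmissible Ω ΓD) (hσ : IsStress Ω ΓD σ d g)
    (hσ1 : ∀ᵐ x ∂(volume.restrict Ω), ‖dev (σ x)‖ ≤ 1)
    (hw : HasH1Gradient Ω w G) (hγw : HasTrace Ω w γw)
    (hk : IsKinAdmissible Ω ΓD γw u γu (fun _ => 0) p)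
    {m : SignedMeasure (Vec n)}
    (hm : Represents m (pairing Ω ΓD σ d g w G γw u γu (fun _ => 0)))
    (hmp : ∀ B, MeasurableSet B → m B = p.variation.real B)
    {ξ : Vec n → Mat n} (hξm : StronglyMeasurable ξ) (hξd : ∀ x, ξ x ∈ devMat n)
    (hξ1 : ∀ x, ‖ξ x‖ ≤ 1) (hpξ : ∀ B, MeasurableSet B → p B = ∫ x in B, ξ x ∂p.variation)
    {N : Set (Vec n)} (hN : MeasurableSet N) (hac : p.variation.restrict Nᶜ ≪ volume) :
    ∀ᵐ x ∂p.variation, x ∈ Ω → x ∉ N → dev (σ x) = ξ x := by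
  have := hk.bounded
  set V := p.variation with hV
  have hT : MeasurableSet (Ω ∩ Nᶜ) := ho.measurableSet.inter hN.compl
  set V' := V.restrict (Ω ∩ Nᶜ) with hV'
  have hac' : V' ≪ volume :=
    (Measure.restrict_mono inter_subset_right le_rfl).absolutelyContinuous.trans hac
  set D := V'.rnDeriv volume with hD
  have hDm : Measurable D := Measure.measurable_rnDeriv _ _
  have hσ1' : ∀ᵐ x ∂V', ‖dev (σ x)‖ ≤ 1 := by
    have h1 : V' ≪ volume.restrict Ω := by
      have : V' = V'.restrict Ω := by
        rw [hV', Measure.restrict_restrict ho.measurableSet, ← inter_assoc, inter_self]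
      rw [this]
      exact hac'.restrict Ω
    exact h1.ae_le hσ1
  -- Truncating at `D ≤ k` makes the strain density `D ξ` bounded, hence an admissible `L²` elastic
  -- strain.
  have key : ∀ k : ℕ, ∀ᵐ x ∂V', D x ≤ k → (D x).toReal =
      (D x).toReal * inner ℝ (dev (σ x)) (ξ x) := by
    intro k
    set S := Ω ∩ Nᶜ ∩ {x | D x ≤ k} with hSdef
    have hS : MeasurableSet S := hT.inter (measurableSet_le hDm measurable_const)
    set e : Vec n → Mat n := S.indicator (fun x => (D x).toReal • ξ x) with he
    have hem : StronglyMeasurable e :=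
      (hDm.ennreal_toReal.stronglyMeasurable.smul hξm).indicator hS
    have hC : ∀ x, ‖e x‖ ≤ k := by
      intro x
      by_cases hx : x ∈ S
      · rw [he, indicator_of_mem hx, norm_smul, Real.norm_of_nonneg ENNReal.toReal_nonneg]
        have h1 : (D x).toReal ≤ k := ENNReal.toReal_le_of_le_ofReal (by positivity)
          (by simpa using hx.2)
        nlinarith [hξ1 x, norm_nonneg (ξ x), ENNReal.toReal_nonneg (a := D x)]
      · rw [he, indicator_of_notMem hx, norm_zero]; positivity
    have hdev : ∀ x, e x ∈ devMat n := by
      intro x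
      by_cases hx : x ∈ S
      · rw [he, indicator_of_mem hx]; exact smul_mem_devMat _ (hξd x)
      · rw [he, indicator_of_notMem hx]; exact zero_mem_devMat
    have hsupp : ∀ x ∉ S, e x = 0 := fun x hx => indicator_of_notMem hx _
    have hSΩ : S ⊆ Ω := fun x hx => hx.1.1
    have hfin : IsFiniteMeasure (volume.restrict Ω) := ⟨by simpa using hb.measure_lt_top⟩
    have hei : Integrable e := by
      rw [← integrableOn_iff_integrable_of_support_subset (s := Ω)]
      · exact Integrable.of_bound hem.aestronglyMeasurable k (Eventually.of_forall hC)
      · intro x hx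
        by_contra h
        exact hx (hsupp x fun h' => h (hSΩ h'))
    have hVV : ∀ B, B ⊆ S → V.restrict B = V'.restrict B := by
      intro B hBS
      rw [hV', Measure.restrict_restrict_of_subset (hBS.trans inter_subset_left)]
    have hpS : p.restrict S = volume.withDensityᵥ e := by
      ext1 B hB
      rw [VectorMeasure.restrict_apply _ hS hB, hpξ _ (hB.inter hS), withDensityᵥ_apply hei hB, he,
        setIntegral_indicator hS, hVV _ inter_subset_right,
        ← setIntegral_rnDeriv_smul hac' (hB.inter hS)]
    -- Both sides equal `m B`: the left because `m` is the variation, the right by the localized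
    -- pairing formula.
    have hBint : ∀ B, MeasurableSet B → B ⊆ S →
        ∫ x in B, (D x).toReal = ∫ x in B, inner ℝ (σ x) (e x) := by
      intro B hB hBS
      rw [← pairing_apply_eq_setIntegral hmeas hb hdisj hadm hσ hw hγw hk hm hS hSΩ hem hC hdev
        hsupp hpS hB hBS, hmp B hB, Measure.setIntegral_toReal_rnDeriv hac', measureReal_def,
        measureReal_def, ← Measure.restrict_apply_self V B, hVV B hBS, Measure.restrict_apply_self]
    have hσe : Integrable (fun x => (inner ℝ (σ x) (e x) : ℝ)) (volume.restrict S) :=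
      (hσ.memLp.integrable_inner_two (MemLp.of_bound hem.aestronglyMeasurable k
        (Eventually.of_forall hC))).mono_measure (Measure.restrict_mono hSΩ le_rfl)
    have heq := Integrable.ae_eq_of_forall_setIntegral_eq (μ := volume.restrict S)
      (fun x => (D x).toReal) (fun x => inner ℝ (σ x) (e x))
      Measure.integrable_toReal_rnDeriv.restrict hσe (fun B hB _ => by
        rw [Measure.restrict_restrict hB]
        exact hBint _ (hB.inter hS) inter_subset_right)
    rw [Filter.EventuallyEq, ae_restrict_iff' hS] at heq
    have hmem : ∀ᵐ x ∂V', x ∈ Ω ∩ Nᶜ := ae_restrict_mem hT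
    filter_upwards [hac'.ae_le heq, hmem] with x hx hxT hxk
    have hxS : x ∈ S := ⟨hxT, hxk⟩
    have h1 := hx hxS
    rw [he, indicator_of_mem hxS, inner_smul_right] at h1
    rw [inner_dev _ (hξd x)]
    exact h1
  have hfinal : ∀ᵐ x ∂V', dev (σ x) = ξ x := by
    rw [← ae_all_iff] at key
    filter_upwards [key, hσ1', Measure.rnDeriv_pos hac', hac'.ae_le (Measure.rnDeriv_lt_top V' volume)]
      -- `D` is positive and finite almost everywhere for `V'`, so some truncation level `k` applies
      -- and `D` can be cancelled.
      with x hx h1 hpos hlt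
    obtain ⟨k, hk⟩ := ENNReal.exists_nat_gt hlt.ne
    have h2 := hx k hk.le
    have h3 : (D x).toReal ≠ 0 := (ENNReal.toReal_pos hpos.ne' hlt.ne).ne'
    exact eq_of_inner_eq_one h1 (hξ1 x) (mul_left_cancel₀ h3 (by rw [← h2, mul_one]))
  rw [hV', ae_restrict_iff' hT] at hfinal
  filter_upwards [hfinal] with x hx h1 h2 using hx ⟨h1, h2⟩

end

/-! ### The reference domain and polar densities -/

section

variable {n : ℕ} {Ω ΓD : Set (Vec n)}

theorem IsReferenceDomain.ne_zero (h : IsReferenceDomain Ω ΓD) : n ≠ 0 := by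
  rintro rfl
  obtain ⟨U, _, hU⟩ := h.dirichlet_open
  have h1 : Ω = univ := Subsingleton.eq_univ_of_nonempty h.isConnected.nonempty
  have h2 := h.dirichlet_nonempty
  rw [hU, h1, frontier_univ, inter_empty] at h2
  exact not_nonempty_empty h2

theorem IsReferenceDomain.dirichlet_subset (h : IsReferenceDomain Ω ΓD) : ΓD ⊆ frontier Ω := by
  obtain ⟨U, _, hU⟩ := h.dirichlet_open
  exact hU ▸ inter_subset_right

theorem IsReferenceDomain.measurableSet_dirichlet (h : IsReferenceDomain Ω ΓD) :
    MeasurableSet ΓD := by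
  obtain ⟨U, hUo, hU⟩ := h.dirichlet_open
  exact hU ▸ hUo.measurableSet.inter isClosed_frontier.measurableSet

theorem IsReferenceDomain.disjoint (h : IsReferenceDomain Ω ΓD) : Disjoint Ω ΓD := by
  have h1 : Disjoint Ω (frontier Ω) := by
    rw [h.isOpen.frontier_eq]; exact disjoint_sdiff_right
  exact h1.mono_right h.dirichlet_subset

theorem IsReferenceDomain.volume_dirichlet (h : IsReferenceDomain Ω ΓD) : volume ΓD = 0 :=
  measure_mono_null h.dirichlet_subset (volume_frontier_eq_zero h.isOpen h.lipschitz)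

/-- Testing with such a function reads off the total mass of a pairing and removes its gradient
term. -/
theorem IsReferenceDomain.exists_test_eq_one (h : IsReferenceDomain Ω ΓD) :
    ∃ φ, IsTest univ φ ∧ (∀ x ∈ Ω ∪ ΓD, φ x = 1) ∧ ∀ x ∈ Ω, gradient φ x = 0 := by
  obtain ⟨R, hR0, hR⟩ : ∃ R > 0, closure Ω ⊆ Metric.ball (0 : Vec n) R := by
    obtain ⟨R, hR⟩ := h.isBounded.closure.subset_ball (0 : Vec n)
    exact ⟨max R 1, by positivity, hR.trans (Metric.ball_subset_ball (le_max_left _ _))⟩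
  let b : ContDiffBump (0 : Vec n) := ⟨R, R + 1, hR0, by linarith⟩
  have h1 : ∀ x ∈ Metric.ball (0 : Vec n) R, b x = 1 := fun x hx =>
    b.one_of_mem_closedBall (Metric.ball_subset_closedBall hx)
  refine ⟨b, ⟨b.contDiff, b.hasCompactSupport, subset_univ _⟩, ?_, ?_⟩
  · rintro x (hx | hx)
    · exact h1 x (hR (subset_closure hx))
    · exact h1 x (hR (frontier_subset_closure (h.dirichlet_subset hx)))
  · intro x hx
    have h2 : (b : Vec n → ℝ) =ᶠ[𝓝 x] fun _ => 1 := by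
      filter_upwards [Metric.isOpen_ball.mem_nhds (hR (subset_closure hx))] with y hy
      exact h1 y hy
    rw [gradient, h2.fderiv_eq]
    simp

/-- A regular representative of the polar density of a measure with values in `devMat`. -/
theorem IsPolarDensity.exists_regular {p : VectorMeasure (Vec n) (Mat n)} {ξ : Vec n → Mat n}
    (hξ : IsPolarDensity p ξ) (hdev : ∀ B, MeasurableSet B → p B ∈ devMat n) :
    ∃ η : Vec n → Mat n, StronglyMeasurable η ∧ (∀ x, η x ∈ devMat n) ∧ (∀ x, ‖η x‖ ≤ 1) ∧
      (∀ B, MeasurableSet B → p B = ∫ x in B, η x ∂p.variation) ∧ ξ =ᵐ[p.variation] η ∧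
      ∀ᵐ x ∂p.variation, ‖η x‖ = 1 := by
  have hp : p = p.variation.withDensityᵥ ξ := by
    ext1 B hB
    rw [withDensityᵥ_apply hξ.integrable hB, hξ.eq_integral B hB]
  have hnorm : ∀ᵐ x ∂p.variation, ‖ξ x‖ = 1 := by
    -- The variation of `p = ξ |p|` is `‖ξ‖ |p|`; comparison with `|p|` gives `‖ξ‖ = 1`.
    have h1 : p.variation.withDensity (fun x => ‖ξ x‖ₑ) = p.variation.withDensity 1 := by
      rw [← Measure.variation_withDensityᵥ hξ.integrable, ← hp, withDensity_one]
    have h2 := (withDensity_eq_iff hξ.integrable.aestronglyMeasurable.enorm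
      aemeasurable_one hξ.integrable.2.ne).1 h1
    filter_upwards [h2] with x hx
    rw [← toReal_enorm, hx]; simp
  have hd : ∀ᵐ x ∂p.variation, ξ x ∈ devMat n :=
    ae_mem_devMat hξ.integrable fun B hB => hξ.eq_integral B hB ▸ hdev B hB
  obtain ⟨ζ, hζm, hζ⟩ := hξ.integrable.aestronglyMeasurable
  have hT : MeasurableSet {x | ζ x ∈ devMat n ∧ ‖ζ x‖ ≤ 1} :=
    (hζm.measurable isClosed_devMat.measurableSet).inter
      (measurableSet_le hζm.norm.measurable measurable_const)
  have hae : ξ =ᵐ[p.variation] {x | ζ x ∈ devMat n ∧ ‖ζ x‖ ≤ 1}.indicator ζ := by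
    filter_upwards [hζ, hnorm, hd] with x h1 h2 h3
    rw [indicator_of_mem (show x ∈ {x | ζ x ∈ devMat n ∧ ‖ζ x‖ ≤ 1} from
      ⟨h1 ▸ h3, h1 ▸ h2.le⟩), h1]
  refine ⟨_, hζm.indicator hT, fun x => ?_, fun x => ?_, fun B hB => ?_, hae, ?_⟩
  · by_cases hx : x ∈ {x | ζ x ∈ devMat n ∧ ‖ζ x‖ ≤ 1}
    · rw [indicator_of_mem hx]; exact hx.1
    · rw [indicator_of_notMem hx]; exact zero_mem_devMat
  · by_cases hx : x ∈ {x | ζ x ∈ devMat n ∧ ‖ζ x‖ ≤ 1}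
    · rw [indicator_of_mem hx]; exact hx.2
    · rw [indicator_of_notMem hx]; simp
  · rw [hξ.eq_integral B hB]
    exact integral_congr_ae (ae_restrict_of_ae hae)
  · filter_upwards [hae, hnorm] with x h1 h2
    rw [← h1, h2]

/-! ### Pairings of solutions and their total masses -/

variable {f g w : Vec n → Vec n} {G : Vec n → Mat n} {γw u γu v γv : Vec n → Vec n}
  {σ τ : Vec n → Mat n} {Ev p : VectorMeasure (Vec n) (Mat n)}

theorem IsSolution.isStress (hf : MemLp f n (volume.restrict Ω))
    (hg : MemLp g ∞ ((surf Ω).restrict (neumann Ω ΓD)))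
    (h : IsSolution Ω ΓD (vonMises n) f g w G γw σ v γv Ev) :
    IsStress Ω ΓD σ (fun x => -f x) g :=
  ⟨h.symm, h.memLp, hf.neg, h.equilibrium, hg, h.traction,
    memLp_top_of_bound (continuous_dev.comp_aestronglyMeasurable h.memLp.1) 1
      (h.yield.mono fun _ hx => hx.2)⟩

theorem IsKinAdmissible.ae_mem {e : Vec n → Mat n} (hmeas : MeasurableSet (Ω ∪ ΓD))
    (hk : IsKinAdmissible Ω ΓD γw u γu e p) : ∀ᵐ x ∂p.variation, x ∈ Ω ∪ ΓD := by
  rw [ae_iff]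
  refine (VectorMeasure.variation_apply_eq_zero hmeas.compl).2 fun B hB _ => ?_
  have h : B ∩ (Ω ∪ ΓD) = ∅ := (disjoint_left.2 hB).inter_eq
  rw [hk.concentrated B ‹_›, h, VectorMeasure.empty]

/-- The pairing of a stress satisfying the yield condition is bounded by the plastic strain. -/
theorem IsSolution.exists_pairing (hadm : IsAdmissible Ω ΓD)
    (hf : MemLp f n (volume.restrict Ω)) (hg : MemLp g ∞ ((surf Ω).restrict (neumann Ω ΓD)))
    (hw : HasH1Gradient Ω w G) (hγw : HasTrace Ω w γw)
    (h : IsSolution Ω ΓD (vonMises n) f g w G γw σ v γv Ev)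
    (hk : IsKinAdmissible Ω ΓD γw u γu (fun _ => 0) p) :
    ∃ m : SignedMeasure (Vec n),
      Represents m (pairing Ω ΓD σ (fun x => -f x) g w G γw u γu (fun _ => 0)) ∧
      m.variation ≤ p.variation := by
  obtain ⟨m, hm, hb⟩ := hadm σ _ g (h.isStress hf hg) w G γw hw hγw u γu _ p hk
  refine ⟨m, hm, hb.trans ?_⟩
  have h1 : eLpNorm (fun x => dev (σ x)) ∞ (volume.restrict Ω) ≤ 1 := by
    rw [eLpNorm_exponent_top]
    simpa using eLpNormEssSup_le_of_ae_bound (C := 1) (h.yield.mono fun _ hx => hx.2)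
  calc _ ≤ (1 : ℝ≥0∞) • p.variation := by gcongr
    _ = _ := one_smul _ _

/-- The pairing of a solution with its own strain rate is the variation of the strain rate. -/
theorem IsSolution.pairing_self (hmeas : MeasurableSet (Ω ∪ ΓD)) (hadm : IsAdmissible Ω ΓD)
    (hf : MemLp f n (volume.restrict Ω)) (hg : MemLp g ∞ ((surf Ω).restrict (neumann Ω ΓD)))
    (hw : HasH1Gradient Ω w G) (hγw : HasTrace Ω w γw)
    (h : IsSolution Ω ΓD (vonMises n) f g w G γw σ v γv Ev) :
    ∃ m : SignedMeasure (Vec n),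
      Represents m (pairing Ω ΓD σ (fun x => -f x) g w G γw v γv (fun _ => 0)) ∧
      m.variation ≤ Ev.variation ∧ ∀ B, MeasurableSet B → m B = Ev.variation.real B := by
  obtain ⟨m, hm, hb⟩ := h.exists_pairing hadm hf hg hw hγw h.strainRate
  obtain ⟨m', hm', ξ, hξ, hmB⟩ := h.flowRule
  -- The measure in the flow rule and the one given by admissibility represent the same
  -- distribution, so the former inherits the variation bound.
  have hmm : m' = m := signedMeasure_ext_of_test fun φ hφ => (hm' φ hφ).trans (hm φ hφ).symm
  subst hmm
  refine ⟨m', hm, hb, fun B hB => ?_⟩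
  have := h.strainRate.bounded
  obtain ⟨η, -, hηd, -, -, hξη, hη1⟩ := hξ.exists_regular h.strainRate.deviatoric
  have hnull : Ev.variation (Ω ∪ ΓD)ᶜ = 0 := h.strainRate.ae_mem hmeas
  have h1 : m' (B ∩ (Ω ∪ ΓD)) = Ev.variation.real (B ∩ (Ω ∪ ΓD)) := by
    rw [hmB _ (hB.inter hmeas) inter_subset_right]
    have : ∀ᵐ x ∂(Ev.variation.restrict (B ∩ (Ω ∪ ΓD))), supportFn (vonMises n) (ξ x) = 1 := by
      refine ae_restrict_of_ae ?_
      filter_upwards [hξη, hη1] with x h1 h2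
      rw [h1, supportFn_vonMises (hηd x), h2]
    rw [integral_congr_ae this]
    simp
  -- The flow rule is silent outside `Ω ∪ Γ_D`; there the variation bound makes `m'` vanish.
  have h2 : m' (B \ (Ω ∪ ΓD)) = 0 := by
    have := (m'.enorm_measure_le_variation (B \ (Ω ∪ ΓD))).trans (hb _)
    rw [measure_mono_null (fun x hx => hx.2) hnull] at this
    simpa using this
  have h3 : Ev.variation.real (B \ (Ω ∪ ΓD)) = 0 := by
    rw [measureReal_def, measure_mono_null (fun x hx => hx.2) hnull, ENNReal.toReal_zero]
  rw [← measureReal_inter_add_sdiff (s := B) hmeas, ← h1, h3, add_zero]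
  conv_lhs => rw [← inter_union_sdiff B (Ω ∪ ΓD)]
  rw [VectorMeasure.of_union (disjoint_sdiff_inter.symm) (hB.inter hmeas) (hB.diff hmeas), h2,
    add_zero]

theorem le_real_of_variation_le {m : SignedMeasure (Vec n)} {μ : Measure (Vec n)}
    [IsFiniteMeasure μ] (hb : m.variation ≤ μ) (A : Set (Vec n)) : m A ≤ μ.real A := by
  refine (le_abs_self _).trans ?_
  rw [← Real.norm_eq_abs, ← toReal_enorm, measureReal_def]
  exact ENNReal.toReal_mono (measure_ne_top _ _) ((m.enorm_measure_le_variation A).trans (hb A))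

/-- The inequality `m ≤ μ` holds on `B` and on `Bᶜ`; equality of the sums leaves no slack in either.
-/
theorem eq_variation_of_univ {m : SignedMeasure (Vec n)} {μ : Measure (Vec n)} [IsFiniteMeasure μ]
    (hb : m.variation ≤ μ) (h : m univ = μ.real univ) {B : Set (Vec n)} (hB : MeasurableSet B) :
    m B = μ.real B := by
  have h1 := le_real_of_variation_le hb B
  have h2 := le_real_of_variation_le hb Bᶜ
  have h3 : m univ = m B + m Bᶜ := by
    rw [← VectorMeasure.of_union disjoint_compl_right hB hB.compl, union_compl_self]
  have h4 : μ.real univ = μ.real B + μ.real Bᶜ := (measureReal_add_measureReal_compl hB).symm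
  linarith

theorem pairing_univ {e : Vec n → Mat n} (hmeas : MeasurableSet (Ω ∪ ΓD))
    (hk : IsKinAdmissible Ω ΓD γw u γu e p) {m : SignedMeasure (Vec n)}
    {T : (Vec n → ℝ) → ℝ} (hm : Represents m T) (hb : m.variation ≤ p.variation)
    {φ : Vec n → ℝ} (hφ : IsTest univ φ) (hφ1 : ∀ x ∈ Ω ∪ ΓD, φ x = 1) : m univ = T φ := by
  have hae : φ =ᵐ[m.variation] fun _ => 1 :=
    (Measure.absolutelyContinuous_of_le hb).ae_le ((hk.ae_mem hmeas).mono hφ1)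
  rw [← hm φ hφ, VectorMeasure.integral_congr_ae hae, VectorMeasure.integral_const]
  simp

/-- The body-force and traction terms are common to both stresses and cancel, and the gradient terms
vanish. The point is that the right-hand side is free of `u`: both velocities give the same value.
-/
theorem pairing_sub_pairing {d : Vec n → Vec n} {φ : Vec n → ℝ}
    (hΩ : IsOpen Ω) (hφ : ∀ x ∈ Ω, gradient φ x = 0) :
    pairing Ω ΓD σ d g w G γw u γu (fun _ => 0) φ - pairing Ω ΓD τ d g w G γw u γu (fun _ => 0) φ =
      (∫ x in Ω, φ x * inner ℝ (σ x) (symPart (G x))) -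
        ∫ x in Ω, φ x * inner ℝ (τ x) (symPart (G x)) := by
  have h : ∀ ρ : Vec n → Mat n,
      ∫ x in Ω, (inner ℝ (ρ x) (symOuter (u x - w x) (gradient φ x)) : ℝ) = 0 := fun ρ => by
    rw [setIntegral_congr_fun hΩ.measurableSet (g := fun _ => (0 : ℝ)), integral_zero]
    intro x hx
    have : symOuter (u x - w x) (gradient φ x) = 0 := by
      ext q; simp [hφ x hx, symOuter]
    simp only [this, inner_zero_right]
  simp only [pairing, h, sub_zero]
  ring

/-- The stresses that attain the dissipation have representatives that coincide. -/
theorem devAgree_of_pairing_eq (hΩ : IsReferenceDomain Ω ΓD) (hadm : IsAdmissible Ω ΓD)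
    {d : Vec n → Vec n} (hw : HasH1Gradient Ω w G) (hγw : HasTrace Ω w γw)
    (hk : IsKinAdmissible Ω ΓD γw u γu (fun _ => 0) p) {ξ : Vec n → Mat n}
    (hξ : IsPolarDensity p ξ) (hσ : IsStress Ω ΓD σ d g) (hτ : IsStress Ω ΓD τ d g)
    (hσ1 : ∀ᵐ x ∂(volume.restrict Ω), ‖dev (σ x)‖ ≤ 1)
    (hτ1 : ∀ᵐ x ∂(volume.restrict Ω), ‖dev (τ x)‖ ≤ 1) {m m' : SignedMeasure (Vec n)}
    (hm : Represents m (pairing Ω ΓD σ d g w G γw u γu (fun _ => 0)))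
    (hmp : ∀ B, MeasurableSet B → m B = p.variation.real B)
    (hm' : Represents m' (pairing Ω ΓD τ d g w G γw u γu (fun _ => 0)))
    (hmp' : ∀ B, MeasurableSet B → m' B = p.variation.real B) :
    DevAgree Ω ΓD p σ τ := by
  classical
  have := hk.bounded
  have hmeas : MeasurableSet (Ω ∪ ΓD) := hΩ.isOpen.measurableSet.union hΩ.measurableSet_dirichlet
  obtain ⟨η, hηm, hηd, hη1, hpη, -, -⟩ := hξ.exists_regular hk.deviatoric
  -- `N` is a Lebesgue null set carrying the singular part of `|p|`.
  obtain ⟨N, hN, hN0, hac⟩ : ∃ N : Set (Vec n), MeasurableSet N ∧ volume N = 0 ∧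
      p.variation.restrict Nᶜ ≪ volume := by
    obtain ⟨A, hA, h1, h2⟩ := Measure.mutuallySingular_singularPart p.variation volume
    refine ⟨Aᶜ, hA.compl, h2, ?_⟩
    rw [compl_compl]
    refine Measure.AbsolutelyContinuous.mk fun s hs h0 => ?_
    rw [Measure.restrict_apply hs, p.variation.haveLebesgueDecomposition_add volume,
      Measure.add_apply, measure_mono_null inter_subset_right h1, zero_add]
    exact withDensity_absolutelyContinuous _ _ (measure_mono_null inter_subset_left h0)
  have main : ∀ ρ : Vec n → Mat n, IsStress Ω ΓD ρ d g →
      (∀ᵐ x ∂p.variation, x ∈ Ω → x ∉ N → dev (ρ x) = η x) →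
      ∃ s : Vec n → Mat n, (∀ x, s x ∈ devMat n) ∧ s =ᵐ[p.variation] η ∧
        ∀ᵐ x ∂(volume.restrict (Ω ∪ ΓD)), s x = dev (ρ x) := by
    intro ρ hρ hae
    -- Replacing `dev ρ` by `η` on `N` and outside `Ω` costs nothing almost everywhere on `Ω ∪ Γ_D`,
    -- since `N` and `Γ_D` are Lebesgue null. The last condition is needed because `ρ` is symmetric
    -- only almost everywhere, whereas the representative must be deviatoric everywhere.
    refine ⟨fun x => if x ∈ Ω ∧ x ∉ N ∧ dev (ρ x) ∈ devMat n then dev (ρ x) else η x,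
      fun x => ?_, ?_, ?_⟩
    · dsimp only
      split_ifs with h
      · exact h.2.2
      · exact hηd x
    · filter_upwards [hae] with x hx
      split_ifs with h
      · exact hx h.1 h.2.1
      · rfl
    · have h1 : ∀ᵐ x ∂(volume : Measure (Vec n)), x ∉ N := measure_eq_zero_iff_ae_notMem.1 hN0
      have h2 : ∀ᵐ x ∂(volume : Measure (Vec n)), x ∉ ΓD :=
        measure_eq_zero_iff_ae_notMem.1 hΩ.volume_dirichlet
      have h3 := (ae_restrict_iff' hΩ.isOpen.measurableSet).1 hρ.symm
      rw [ae_restrict_iff' hmeas]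
      filter_upwards [h1, h2, h3] with x hx1 hx2 hx3 hx
      have hxΩ : x ∈ Ω := hx.resolve_right hx2
      rw [if_pos ⟨hxΩ, hx1, dev_mem_devMat hΩ.ne_zero (hx3 hxΩ)⟩]
  obtain ⟨s₁, hd₁, he₁, hv₁⟩ := main σ hσ (ae_dev_eq_polar hmeas hΩ.isOpen hΩ.isBounded hΩ.disjoint
    hadm hσ hσ1 hw hγw hk hm hmp hηm hηd hη1 hpη hN hac)
  obtain ⟨s₂, hd₂, he₂, hv₂⟩ := main τ hτ (ae_dev_eq_polar hmeas hΩ.isOpen hΩ.isBounded hΩ.disjoint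
    hadm hτ hτ1 hw hγw hk hm' hmp' hηm hηd hη1 hpη hN hac)
  have hη : MemLp η ∞ (p.variation.restrict (Ω ∪ ΓD)) :=
    memLp_top_of_bound hηm.aestronglyMeasurable 1 (Eventually.of_forall hη1)
  exact ⟨s₁, s₂, hd₁, hd₂, hη.ae_eq (ae_restrict_of_ae he₁.symm),
    hη.ae_eq (ae_restrict_of_ae he₂.symm), hv₁, hv₂, ae_restrict_of_ae (he₁.trans he₂.symm)⟩

end

end RigidPlastic

end

/-! ### The exchange argument for two solutions -/

open RigidPlastic in
theorem proposition4p2 (n : ℕ) (Ω ΓD : Set (Vec n))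
    (hΩ : IsReferenceDomain Ω ΓD) (hadm : IsAdmissible Ω ΓD)
    (f g w : Vec n → Vec n) (G : Vec n → Mat n) (γw : Vec n → Vec n)
    (hf : MemLp f n (volume.restrict Ω))
    (hg : MemLp g ∞ ((surf Ω).restrict (neumann Ω ΓD)))
    (hw : HasH1Gradient Ω w G) (hγw : HasTrace Ω w γw)
    (σ₁ σ₂ : Vec n → Mat n) (v₁ γv₁ v₂ γv₂ : Vec n → Vec n)
    (Ev₁ Ev₂ : VectorMeasure (Vec n) (Mat n))
    (h₁ : IsSolution Ω ΓD (vonMises n) f g w G γw σ₁ v₁ γv₁ Ev₁)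
    (h₂ : IsSolution Ω ΓD (vonMises n) f g w G γw σ₂ v₂ γv₂ Ev₂) :
    DevAgree Ω ΓD Ev₁ σ₁ σ₂ ∧ DevAgree Ω ΓD Ev₂ σ₁ σ₂ := by
  have hmeas : MeasurableSet (Ω ∪ ΓD) := hΩ.isOpen.measurableSet.union hΩ.measurableSet_dirichlet
  have hfin₁ := h₁.strainRate.bounded
  have hfin₂ := h₂.strainRate.bounded
  obtain ⟨m₁₁, r₁₁, b₁₁, e₁₁⟩ := h₁.pairing_self hmeas hadm hf hg hw hγw
  obtain ⟨m₂₂, r₂₂, b₂₂, e₂₂⟩ := h₂.pairing_self hmeas hadm hf hg hw hγw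
  obtain ⟨m₂₁, r₂₁, b₂₁⟩ := h₂.exists_pairing hadm hf hg hw hγw h₁.strainRate
  obtain ⟨m₁₂, r₁₂, b₁₂⟩ := h₁.exists_pairing hadm hf hg hw hγw h₂.strainRate
  obtain ⟨φ, hφ, hφ1, hφ0⟩ := hΩ.exists_test_eq_one
  have t₁₁ := pairing_univ hmeas h₁.strainRate r₁₁ b₁₁ hφ hφ1
  have t₂₁ := pairing_univ hmeas h₁.strainRate r₂₁ b₂₁ hφ hφ1
  have t₁₂ := pairing_univ hmeas h₂.strainRate r₁₂ b₁₂ hφ hφ1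
  have t₂₂ := pairing_univ hmeas h₂.strainRate r₂₂ b₂₂ hφ hφ1
  have d₁ := pairing_sub_pairing (ΓD := ΓD) (σ := σ₁) (τ := σ₂) (d := fun x => -f x) (g := g)
    (w := w) (G := G) (γw := γw) (u := v₁) (γu := γv₁) hΩ.isOpen hφ0
  have d₂ := pairing_sub_pairing (ΓD := ΓD) (σ := σ₁) (τ := σ₂) (d := fun x => -f x) (g := g)
    (w := w) (G := G) (γw := γw) (u := v₂) (γu := γv₂) hΩ.isOpen hφ0
  have u₁₁ := e₁₁ univ MeasurableSet.univ
  have u₂₂ := e₂₂ univ MeasurableSet.univ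
  have l₂₁ := le_real_of_variation_le b₂₁ univ
  have l₁₂ := le_real_of_variation_le b₁₂ univ
  -- In total mass `m₁₁ - m₂₁ = m₁₂ - m₂₂`, by `d₁` and `d₂`; the left side is nonnegative and the
  -- right side nonpositive, so both vanish.
  have u₂₁ : m₂₁ univ = Ev₁.variation.real univ := by linarith
  have u₁₂ : m₁₂ univ = Ev₂.variation.real univ := by linarith
  obtain ⟨_, _, ξ₁, hξ₁, -⟩ := h₁.flowRule
  obtain ⟨_, _, ξ₂, hξ₂, -⟩ := h₂.flowRule
  have y₁ := h₁.yield.mono fun _ hx => hx.2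
  have y₂ := h₂.yield.mono fun _ hx => hx.2
  exact ⟨devAgree_of_pairing_eq hΩ hadm hw hγw h₁.strainRate hξ₁ (h₁.isStress hf hg)
      (h₂.isStress hf hg) y₁ y₂ r₁₁ e₁₁ r₂₁ fun B hB => eq_variation_of_univ b₂₁ u₂₁ hB,
    devAgree_of_pairing_eq hΩ hadm hw hγw h₂.strainRate hξ₂ (h₁.isStress hf hg)
      (h₂.isStress hf hg) y₁ y₂ r₁₂ (fun B hB => eq_variation_of_univ b₁₂ u₁₂ hB) r₂₂ e₂₂⟩
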